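/- **Theorem 1.3 (Existence of Tight Indiscernibles).** Let $\mathcal M$ be an infinite first-order structure with universe $M$ and language $\mathcal L(\mathcal M)$. Then there is an expansion $\mathcal M_1$ of $\mathcal M$ (same universe, larger language, same interpretation of the symbols of $\mathcal L(\mathcal M)$) such that $|\mathcal L(\mathcal M_1)|=\max\{|\mathcal L(\mathcal M)|,\aleph_0\}$, $\mathcal M_1$ has definable Skolem functions, and for every linearly ordered set $(I,<)$ with $I$ disjoint from $M$ there is an elementary extension $\mathcal M^*\succ\mathcal M_1$ with $I\subseteq M^*\setminus M$ such that $(I,<)$ forms a set of tight indiscernibles generating $\mathcal M^*$ over $\mathcal M_1$. Here $\mathcal M_1$ *has definable Skolem functions* if for every $k\ge 0$ and every $\mathcal L(\mathcal M_1)$-formula $\varphi(x,y_1,\dots,y_k)$ there is a function $f:M^k\to M$ whose graph is definable in $\mathcal M_1$ without parameters, such that $\mathcal M_1\models\forall y_1\cdots\forall y_k\,\bigl(\exists x\,\varphi(x,y_1,\dots,y_k)\to\varphi(f(y_1,\dots,y_k),y_1,\dots,y_k)\bigr)$. A function $f:M^k\to M$ is *parametrically $\mathcal M_1$-definable* if its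 graph is definable in $\mathcal M_1$ by a formula with parameters from $M$; such an $f$ extends to a function $(M^*)^k\to M^*$, also denoted $f$, defined in $\mathcal M^*$ by the same formula. That $(I,<)$ *forms a set of tight indiscernibles generating $\mathcal M^*$ over $\mathcal M_1$* means: 1. for every $\mathcal L(\mathcal M_1)$-formula $\varphi(x_1,\dots,x_n,y_1,\dots,y_k)$, all $m_1,\dots,m_n\in M$ and all $i_1<\dots<i_k$ and $j_1<\dots<j_k$ from $I$, $$\mathcal M^*\models\varphi(m_1,\dots,m_n,i_1,\dots,i_k)\leftrightarrow\varphi(m_1,\dots,m_n,j_1,\dots,j_k);$$ 2. every element of $\mathcal M^*$ is of the form $f(i_1,\dots,i_k)$ for some $k\ge 0$, some $i_1,\dots,i_k\in I$ and some parametrically $\mathcal M_1$-definable function $f:M^k\to M$; 3. for all $i_1<\dots<i_k<j_1<\dots<j_k$ from $I$ and every parametrically $\mathcal M_1$-definable function $f:M^k\to M$, if $f(i_1,\dots,i_k)=f(j_1,\dots,j_k)$, then this common value is in $M$. -/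

import Mathlib

universe u v x y w

namespace TightIndiscernibles

open FirstOrder FirstOrder.Language

/-- `M` has definable Skolem functions: for every formula `φ(x, y₁, …, y_k)` without parameters
(`none` stands for the distinguished variable `x`, `some i` for `y_i`, and `k = 0` is allowed)
there is a function `f : M ^ k → M`, definable without parameters, such that
`M ⊨ ∀ y (∃ x φ(x, y) → φ(f(y), y))`. -/
def HasDefinableSkolemFunctions (L : FirstOrder.Language.{u, v}) (M : Type x) [L.Structure M] : Prop :=
  ∀ (k : ℕ) (φ : L.Formula (Option (Fin k))),
    ∃ f : (Fin k → M) → M, (∅ : Set M).DefinableFun L f ∧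
      ∀ b : Fin k → M, (∃ a : M, φ.Realize (fun o => o.elim a b)) →
        φ.Realize (fun o => o.elim (f b) b)

section

variable {L : FirstOrder.Language.{u, v}} {M : Type x} {N : Type y} [L.Structure M] [L.Structure N]

/-- `F : N ^ k → N` is the natural extension of the parametrically definable function
`f : M ^ k → M` to the elementary extension `e : M ↪ₑ[L] N`: some formula with parameters
from `M` that defines the graph of `f` in `M` defines the graph of `F` in `N`. In `φ`, a variable
`Sum.inl m` is the name of the parameter `m`. By `existsUnique_isNaturalExtension`
there is exactly one such `F`. -/
def IsNaturalExtension (e : M ↪ₑ[L] N) {k : ℕ} (f : (Fin k → M) → M)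
    (F : (Fin k → N) → N) : Prop :=
  ∃ φ : L.Formula (M ⊕ Option (Fin k)),
    (∀ (b : Fin k → M) (a : M),
      f b = a ↔ φ.Realize (Sum.elim (fun m => m) (fun o => o.elim a b))) ∧
    (∀ (b : Fin k → N) (a : N),
      F b = a ↔ φ.Realize (Sum.elim (fun m => e m) (fun o => o.elim a b)))

/-- The natural extension of a parametrically definable function exists and does not depend on
the defining formula. -/
theorem existsUnique_isNaturalExtension (e : M ↪ₑ[L] N) {k : ℕ} (f : (Fin k → M) → M)
    (hf : (Set.univ : Set M).DefinableFun L f) :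
    ∃! F : (Fin k → N) → N, IsNaturalExtension e f F := by
  have key : ∀ φ : L.Formula (M ⊕ Option (Fin k)),
      (∀ (b : Fin k → M) (a : M),
        f b = a ↔ φ.Realize (Sum.elim (fun m => m) (fun o => o.elim a b))) →
      ∀ b : Fin k → N, ∃! a : N, φ.Realize (Sum.elim (fun m => e m) (fun o => o.elim a b)) := by
    intro φ hφ
    let g : M ⊕ Option (Fin k) → (M ⊕ Fin k) ⊕ Unit :=
      Sum.elim (fun m => .inl (.inl m)) (fun o => o.elim (.inr ()) (fun s => .inl (.inr s)))
    have compM : ∀ (c : M → M) (b : Fin k → M) (i : Unit → M),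
        Sum.elim (Sum.elim c b) i ∘ g = Sum.elim c (fun o => o.elim (i ()) b) := by
      intro c b i
      funext t
      rcases t with m | _ | s <;> rfl
    have compN : ∀ (c : M → N) (b : Fin k → N) (i : Unit → N),
        Sum.elim (Sum.elim c b) i ∘ g = Sum.elim c (fun o => o.elim (i ()) b) := by
      intro c b i
      funext t
      rcases t with m | _ | s <;> rfl
    have h := e.map_formula (((φ.relabel g).iExsUnique Unit).iAlls (Fin k)) (fun m : M => m)
    simp only [Formula.realize_iAlls, Formula.realize_iExsUnique, Formula.realize_relabel,
      compM, compN] at h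
    intro b
    have hM : ∀ i : Fin k → M, ∃! j : Unit → M,
        φ.Realize (Sum.elim (fun m => m) (fun o => o.elim (j ()) i)) := fun i =>
      ⟨fun _ => f i, (hφ i (f i)).1 rfl, fun j hj => funext fun _ => ((hφ i (j ())).2 hj).symm⟩
    obtain ⟨j, hj, hu⟩ := h.2 hM b
    exact ⟨j (), hj, fun a ha => congrFun (hu (fun _ => a) ha) ()⟩
  obtain ⟨ψ, hψ⟩ := Set.definable_iff_exists_formula_sum.1 hf
  have hφ : ∀ (b : Fin k → M) (a : M), f b = a ↔
      (Formula.relabel (Sum.map (fun m : (Set.univ : Set M) => (m : M)) id) ψ).Realize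
        (Sum.elim (fun m => m) (fun o => o.elim a b)) := by
    intro b a
    have h1 := Set.ext_iff.1 hψ (fun o => o.elim a b)
    rw [Formula.realize_relabel, Sum.elim_comp_map]
    exact h1
  choose F hF hFu using key _ hφ
  refine ⟨F, ⟨_, hφ, fun b a => ⟨?_, fun h => (hFu b a h).symm⟩⟩, ?_⟩
  · rintro rfl
    exact hF b
  · rintro G ⟨χ, hχ, hG⟩
    let θ := ((Formula.relabel (Sum.map (fun m : (Set.univ : Set M) => (m : M)) id) ψ).iff
      χ).iAlls (Option (Fin k))
    have h := e.map_formula θ (fun m : M => m)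
    simp only [θ, Formula.realize_iAlls, Formula.realize_iff] at h
    have h2 := h.2 (fun v => by
      have hv : v = fun o => o.elim (v none) (fun s => v (some s)) := by
        funext o; cases o <;> rfl
      rw [hv]
      exact (hφ _ _).symm.trans (hχ _ _))
    funext b
    exact hFu b (G b) ((h2 (fun o => o.elim (G b) b)).2 ((hG b (G b)).1 rfl))

/-- `(I, <)`, placed inside the elementary extension `e : M ↪ₑ[L] N` by `ι : I → N`, is a set of
order indiscernibles over `M`: increasing tuples of the same length from `I` satisfy in `N`
the same formulas with parameters from `M`. -/
def IsOrderIndiscernible (e : M ↪ₑ[L] N) {I : Type w} [LinearOrder I] (ι : I → N) : Prop :=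
  ∀ (k : ℕ) (φ : L.Formula (M ⊕ Fin k)) (i j : Fin k → I), StrictMono i → StrictMono j →
    (φ.Realize (Sum.elim (fun m => e m) (fun s => ι (i s))) ↔
      φ.Realize (Sum.elim (fun m => e m) (fun s => ι (j s))))

/-- `(I, <)`, placed inside the elementary extension `e : M ↪ₑ[L] N` by `ι : I → N`, is a set of
tight indiscernibles generating `N` over `M`. -/
structure IsTightIndiscernibles (e : M ↪ₑ[L] N) {I : Type w} [LinearOrder I] (ι : I → N) :
    Prop where
  /-- `ι` identifies `I` with a subset of `N` … -/
  injective : Function.Injective ι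
  /-- … which lies in `N \ M`. -/
  notMem : ∀ i : I, ι i ∉ Set.range e
  /-- `(I, <)` is a set of order indiscernibles over `M`. -/
  indiscernible : IsOrderIndiscernible e ι
  /-- `N` is generated by `M ∪ I`: every element of `N` is `f(i₁, …, i_k)` for some parametrically
  definable function `f` of `M` and some `i₁, …, i_k` from `I`, in any order
  (`k = 0` gives the elements of `M`). -/
  generates : ∀ a : N, ∃ (k : ℕ) (f : (Fin k → M) → M) (F : (Fin k → N) → N) (i : Fin k → I),
    (Set.univ : Set M).DefinableFun L f ∧ IsNaturalExtension e f F ∧ F (fun s => ι (i s)) = a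
  /-- If `i₁ < … < i_k < j₁ < … < j_k` in `I` and `f(i₁, …, i_k) = f(j₁, …, j_k)` for a
  parametrically definable function `f` of `M`, then the common value is in `M`. -/
  tight : ∀ (k : ℕ) (f : (Fin k → M) → M) (F : (Fin k → N) → N) (i j : Fin k → I),
    (Set.univ : Set M).DefinableFun L f → IsNaturalExtension e f F →
    StrictMono i → StrictMono j → (∀ s t, i s < j t) →
    F (fun s => ι (i s)) = F (fun s => ι (j s)) → F (fun s => ι (i s)) ∈ Set.range e

end

end TightIndiscernibles

/-!
The expansion adds to the language a well-order `≺` of `M` (and countably many idle relation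
symbols, so that the language has the right cardinality even if the original one is finite). The
`≺`-least witness of a formula is definable, so the expansion has definable Skolem functions.

The extension generated by `I` is found inside a single ultrapower of `M` with index set `I → M`.
Fix a nonprincipal ultrafilter `U` on `M`. There is an ultrafilter `W` on `I → M`
(`iteratedLimit`) such that, for `i₁ < … < i_k`, the projection of `W` to the coordinates
`i₁, …, i_k` is the iterated power `U ⊗ ⋯ ⊗ U`; thus `∀ᶠ x in W, P (x i₁, …, x i_k)` means that
`P (b₁, …, b_k)` holds for `U`-almost all `b₁`, for `U`-almost all `b₂`, and so on
(`eventually_iteratedLimit`). The element `i` of `I` is interpreted as the class of the coordinate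
function `x ↦ x i`. By Łoś's theorem these classes are order indiscernible over `M`, since the
iterated power depends on `k` only.

The structure `N` consists of the classes of the functions `g : (I → M) → M` that are definable
with parameters. It is closed under the definable Skolem functions, hence is an elementary
substructure of the ultrapower by the Tarski–Vaught test
(`definableSubstructure_isElementary`). A formula has finitely many free variables, so each such
`g` depends on finitely many coordinates (`exists_definableFun_comp_eq`), and so `M ∪ I` generates
`N`.

Tightness is a Fubini argument (`exists_of_eventually_iteratedLimit`): if
`f(i₁, …, i_k) = f(j₁, …, j_k)` with `i₁ < … < i_k < j₁ < … < j_k`, then for almost all tuples `a`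
we have `f a = f b` for almost all tuples `b`. Any single such `a` shows that the common value is
the element `f a` of `M`.
-/

namespace TightIndiscernibles

open FirstOrder FirstOrder.Language Filter

/-! ### Iterated powers of an ultrafilter along a linear order -/

section Ultrafilters

variable {M : Type x} {I : Type w} [LinearOrder I]

theorem eventually_ultrafilter_bind {α β : Type*} {U : Ultrafilter α} {f : α → Ultrafilter β}
    {p : β → Prop} :
    (∀ᶠ b in (U.bind f : Filter β), p b) ↔ ∀ᶠ a in (U : Filter α), ∀ᶠ b in (f a : Filter β), p b :=
  Iff.rfl

/-- The iterated power `U ⊗ ⋯ ⊗ U` on `k`-tuples. The quantifier over the first entry is the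
outermost one: `P` holds almost everywhere if `∀ᶠ b₀ in U, ∀ᶠ b₁ in U, …, P (b₀, b₁, …)`. -/
def ultrafilterPower (U : Ultrafilter M) : (k : ℕ) → Ultrafilter (Fin k → M)
  | 0 => pure Fin.elim0
  | k + 1 => U.bind fun a => (ultrafilterPower U k).map (Fin.cons a)

/-- The ultrafilter on `I → M` that chooses the values at the entries of a list from `U`, the head
of the list outermost, and is concentrated on `d` at all other coordinates. -/
def listLimit (U : Ultrafilter M) (d : M) : List I → Ultrafilter (I → M)
  | [] => pure fun _ => d
  | c :: l => U.bind fun a => (listLimit U d l).map fun x => Function.update x c a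

theorem eventually_ultrafilterPower_succ {U : Ultrafilter M} {k : ℕ}
    {P : (Fin (k + 1) → M) → Prop} :
    (∀ᶠ b in (ultrafilterPower U (k + 1) : Filter (Fin (k + 1) → M)), P b) ↔
      ∀ᶠ a in (U : Filter M), ∀ᶠ b in (ultrafilterPower U k : Filter (Fin k → M)),
        P (Fin.cons a b) :=
  Iff.rfl

theorem eventually_listLimit_cons {U : Ultrafilter M} {d : M} {c : I} {l : List I}
    {P : (I → M) → Prop} :
    (∀ᶠ x in (listLimit U d (c :: l) : Filter (I → M)), P x) ↔
      ∀ᶠ a in (U : Filter M), ∀ᶠ x in (listLimit U d l : Filter (I → M)),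
        P (Function.update x c a) :=
  Iff.rfl

theorem update_comp_of_head {k : ℕ} {i : Fin (k + 1) → I} (hi : StrictMono i) {c : I}
    (hc : i 0 = c) (x : I → M) (a : M) :
    Function.update x c a ∘ i = Fin.cons a (x ∘ i ∘ Fin.succ) := by
  subst hc
  funext t
  refine Fin.cases ?_ (fun t => ?_) t
  · simp
  · simp [(hi (Fin.succ_pos t)).ne']

theorem eq_head_of_mem_range {k : ℕ} {i : Fin (k + 1) → I} (hi : StrictMono i) {c : I} {l : List I}
    (hl : (c :: l).Pairwise (· < ·)) (hil : ∀ t, i t ∈ c :: l) (hc : c ∈ Set.range i) :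
    i 0 = c := by
  obtain ⟨t, rfl⟩ := hc
  rcases List.mem_cons.1 (hil 0) with h | h
  · exact h
  · exact absurd (hi.monotone (Fin.zero_le t)) ((List.pairwise_cons.1 hl).1 _ h).not_ge

theorem mem_tail_of_notMem_range {I : Type*} {k : ℕ} {i : Fin k → I} {c : I} {l : List I}
    (hil : ∀ t, i t ∈ c :: l) (hc : c ∉ Set.range i) (t : Fin k) : i t ∈ l :=
  (List.mem_cons.1 (hil t)).resolve_left fun h => hc ⟨t, h⟩

theorem succ_mem_tail {k : ℕ} {i : Fin (k + 1) → I} (hi : StrictMono i) {c : I} {l : List I}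
    (hil : ∀ t, i t ∈ c :: l) (hc : i 0 = c) (t : Fin k) : (i ∘ Fin.succ) t ∈ l :=
  (List.mem_cons.1 (hil t.succ)).resolve_left fun h =>
    (hi (Fin.succ_pos t)).ne (hc.trans h.symm)

/-- On an increasing tuple of entries of an increasing list, the ultrafilter of the list induces the
iterated power: the quantifiers over the other entries are idle. -/
theorem eventually_listLimit (U : Ultrafilter M) (d : M) {l : List I}
    (hl : l.Pairwise (· < ·)) {k : ℕ} {i : Fin k → I} (hi : StrictMono i) (hil : ∀ t, i t ∈ l)
    {P : (Fin k → M) → Prop} :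
    (∀ᶠ x in (listLimit U d l : Filter (I → M)), P (x ∘ i)) ↔
      ∀ᶠ b in (ultrafilterPower U k : Filter (Fin k → M)), P b := by
  induction l generalizing k with
  | nil =>
    cases k with
    | zero => exact iff_of_eq (congrArg P (Subsingleton.elim _ _))
    | succ k => exact absurd (hil 0) (by simp)
  | cons c l ih =>
    have hl' := (List.pairwise_cons.1 hl).2
    by_cases hc : c ∈ Set.range i
    · cases k with
      | zero => obtain ⟨t, -⟩ := hc; exact t.elim0
      | succ k =>
        have h0 := eq_head_of_mem_range hi hl hil hc
        rw [eventually_listLimit_cons, eventually_ultrafilterPower_succ]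
        refine eventually_congr (.of_forall fun a => ?_)
        simp only [update_comp_of_head hi h0]
        exact ih hl' (hi.comp (Fin.strictMono_succ)) (succ_mem_tail hi hil h0)
          (P := fun b => P (Fin.cons a b))
    -- The quantifier over a coordinate outside `i` is vacuous.
    · simp only [eventually_listLimit_cons, Function.update_comp_eq_of_notMem_range _ _ hc,
        eventually_const]
      exact ih hl' hi (mem_tail_of_notMem_range hil hc)

/-- If all entries of `i` lie below those of `j`, the quantifiers over the coordinates in `i` come
before those over the coordinates in `j`, so the former can be instantiated at a fixed tuple `a`. -/
theorem exists_of_eventually_listLimit (U : Ultrafilter M) (d : M) {l : List I}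
    (hl : l.Pairwise (· < ·)) {k n : ℕ} {i : Fin k → I} {j : Fin n → I}
    (hi : StrictMono i) (hj : StrictMono j) (hij : ∀ s t, i s < j t)
    (hil : ∀ t, i t ∈ l) (hjl : ∀ t, j t ∈ l) {P : (Fin k → M) → (Fin n → M) → Prop}
    (h : ∀ᶠ x in (listLimit U d l : Filter (I → M)), P (x ∘ i) (x ∘ j)) :
    ∃ a, ∀ᶠ b in (ultrafilterPower U n : Filter (Fin n → M)), P a b := by
  induction l generalizing k with
  | nil =>
    cases k with
    | zero =>
      refine ⟨Fin.elim0, (eventually_listLimit U d hl hj hjl).1 (h.mono fun x hx => ?_)⟩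
      rwa [Subsingleton.elim Fin.elim0 (x ∘ i)]
    | succ k => exact absurd (hil 0) (by simp)
  | cons c l ih =>
    have hl' := (List.pairwise_cons.1 hl).2
    cases k with
    | zero =>
      refine ⟨Fin.elim0, (eventually_listLimit U d hl hj hjl).1 (h.mono fun x hx => ?_)⟩
      rwa [Subsingleton.elim Fin.elim0 (x ∘ i)]
    | succ k =>
      -- The head `c` is at most `i 0`, so it is no entry of `j`, and its value can be fixed now.
      have hci : c ≤ i 0 := by
        rcases List.mem_cons.1 (hil 0) with h | h
        · exact h.ge
        · exact ((List.pairwise_cons.1 hl).1 _ h).le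
      have hcj : c ∉ Set.range j := by
        rintro ⟨t, rfl⟩
        exact (hij 0 t).not_ge hci
      obtain ⟨u, hu⟩ := (eventually_listLimit_cons.1 h).exists
      simp only [Function.update_comp_eq_of_notMem_range _ _ hcj] at hu
      by_cases hc : c ∈ Set.range i
      · have h0 := eq_head_of_mem_range hi hl hil hc
        simp only [update_comp_of_head hi h0] at hu
        obtain ⟨a, ha⟩ := ih hl' (hi.comp (Fin.strictMono_succ)) (fun s t => hij _ t)
          (succ_mem_tail hi hil h0) (mem_tail_of_notMem_range hjl hcj)
          (P := fun a b => P (Fin.cons u a) b) hu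
        exact ⟨_, ha⟩
      · simp only [Function.update_comp_eq_of_notMem_range _ _ hc] at hu
        exact ih hl' hi hij (mem_tail_of_notMem_range hil hc) (mem_tail_of_notMem_range hjl hcj) hu

/-- The iterated power of `U` along `I`, as an ultrafilter on `I → M`: the limit of the ultrafilters
`listLimit U d s`, for `s` a finite subset of `I` listed in increasing order, along an ultrafilter
that contains all sets `{s | s₀ ⊆ s}`. The value `d` plays no role beyond making `listLimit`
total. -/
noncomputable def iteratedLimit (I : Type w) [LinearOrder I] (U : Ultrafilter M) (d : M) :
    Ultrafilter (I → M) :=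
  (Ultrafilter.of (atTop : Filter (Finset I))).bind fun s => listLimit U d (s.sort (· ≤ ·))

theorem eventually_forall_mem_sort {k : ℕ} (i : Fin k → I) :
    ∀ᶠ s in (Ultrafilter.of (atTop : Filter (Finset I)) : Filter (Finset I)),
      ∀ t, i t ∈ s.sort (· ≤ ·) := by
  refine Ultrafilter.of_le _ ((eventually_ge_atTop (Finset.univ.image i)).mono fun s hs t => ?_)
  exact (Finset.mem_sort _).2 (hs (Finset.mem_image_of_mem i (Finset.mem_univ t)))

theorem eventually_iteratedLimit (U : Ultrafilter M) (d : M) {k : ℕ} {i : Fin k → I}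
    (hi : StrictMono i) {P : (Fin k → M) → Prop} :
    (∀ᶠ x in (iteratedLimit I U d : Filter (I → M)), P (x ∘ i)) ↔
      ∀ᶠ b in (ultrafilterPower U k : Filter (Fin k → M)), P b := by
  rw [iteratedLimit, eventually_ultrafilter_bind, ← eventually_const
    (f := (Ultrafilter.of (atTop : Filter (Finset I)) : Filter (Finset I)))
    (p := ∀ᶠ b in (ultrafilterPower U k : Filter (Fin k → M)), P b)]
  refine eventually_congr ((eventually_forall_mem_sort i).mono fun s hs => ?_)
  exact eventually_listLimit U d s.sortedLT_sort.pairwise hi hs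

/-- The Fubini argument behind tightness. -/
theorem exists_of_eventually_iteratedLimit (U : Ultrafilter M) (d : M) {k n : ℕ}
    {i : Fin k → I} {j : Fin n → I} (hi : StrictMono i) (hj : StrictMono j)
    (hij : ∀ s t, i s < j t) {P : (Fin k → M) → (Fin n → M) → Prop}
    (h : ∀ᶠ x in (iteratedLimit I U d : Filter (I → M)), P (x ∘ i) (x ∘ j)) :
    ∃ a, ∀ᶠ x in (iteratedLimit I U d : Filter (I → M)), P a (x ∘ j) := by
  obtain ⟨s, hs, his, hjs⟩ := ((eventually_ultrafilter_bind.1 h).and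
    ((eventually_forall_mem_sort i).and (eventually_forall_mem_sort j))).exists
  obtain ⟨a, ha⟩ := exists_of_eventually_listLimit U d s.sortedLT_sort.pairwise hi hj hij his hjs hs
  exact ⟨a, (eventually_iteratedLimit U d hj).2 ha⟩

theorem not_eventually_iteratedLimit_eq {U : Ultrafilter M} (hU : ∀ m, {m} ∉ U) (d : M) (i : I)
    (m : M) : ¬ ∀ᶠ x in (iteratedLimit I U d : Filter (I → M)), x i = m := by
  intro h
  have h1 := (eventually_iteratedLimit U d (i := fun _ : Fin 1 => i)
    (Subsingleton.strictMono _) (P := fun b => b 0 = m)).1 h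
  exact hU m h1

theorem not_eventually_iteratedLimit_eq_of_lt {U : Ultrafilter M} (hU : ∀ m, {m} ∉ U) (d : M)
    {i j : I} (hij : i < j) :
    ¬ ∀ᶠ x in (iteratedLimit I U d : Filter (I → M)), x i = x j := by
  intro h
  obtain ⟨a, ha⟩ := exists_of_eventually_iteratedLimit U d (i := fun _ : Fin 1 => i)
    (j := fun _ : Fin 1 => j) (Subsingleton.strictMono _) (Subsingleton.strictMono _)
    (fun _ _ => hij) (P := fun a b => a 0 = b 0) h
  exact not_eventually_iteratedLimit_eq hU d j (a 0) (ha.mono fun x hx => hx.symm)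

end Ultrafilters

/-! ### Definable Skolem functions from a definable well-order -/

section Skolem

variable {L : FirstOrder.Language.{u, v}} {M : Type x} [L.Structure M]

/-- Projecting away the distinguished variable `none` preserves definability. -/
theorem definable_exists_option {α : Type*} {A : Set M} {D : Set (Option α → M)}
    (hD : A.Definable L D) : A.Definable L {b : α → M | ∃ a, (fun o => o.elim a b) ∈ D} := by
  have h := hD.preimage_comp (fun o : Option α => o.elim (Sum.inr ()) Sum.inl : _ → α ⊕ Unit)
  convert! h.exists_of_finite using 1
  ext b
  have key : ∀ c : Unit → M, (Sum.elim b c ∘ fun o : Option α => o.elim (Sum.inr ()) Sum.inl) =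
      fun o => o.elim (c ()) b := fun c => by
    funext o; cases o <;> rfl
  simp only [Set.mem_ofPred_eq, Set.mem_preimage, key]
  exact ⟨fun ⟨a, ha⟩ => ⟨fun _ => a, ha⟩, fun ⟨c, hc⟩ => ⟨c (), hc⟩⟩

/-- If a well-order of `M` is definable, choosing the least witness is definable. -/
theorem hasDefinableSkolemFunctions_of_wellOrder [Nonempty M] {r : M → M → Prop} [IsWellOrder M r]
    (hr : (∅ : Set M).Definable L {b : Fin 2 → M | r (b 0) (b 1)}) :
    HasDefinableSkolemFunctions L M := by
  intro k φ
  -- Every element counts as a witness over tuples that have none, so that witnesses always exist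
  -- and the least one is a total function, definable without parameters.
  let D : Set (Option (Fin k) → M) :=
    {b | (∃ a, φ.Realize fun o => o.elim a (b ∘ some)) → φ.Realize b}
  have eta : ∀ b : Option (Fin k) → M, (fun o => o.elim (b none) (b ∘ some)) = b := fun b => by
    funext o; cases o <;> rfl
  have hφ : (∅ : Set M).Definable L {b : Option (Fin k) → M | φ.Realize b} :=
    Set.empty_definable_iff.2 ⟨φ, rfl⟩
  have hD : (∅ : Set M).Definable L D :=
    ((definable_exists_option hφ).preimage_comp some).himp hφ
  have hne : ∀ b : Fin k → M, {a : M | (fun o : Option (Fin k) => o.elim a b) ∈ D}.Nonempty := by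
    intro b
    by_cases h : ∃ a, φ.Realize (fun o => o.elim a b)
    · obtain ⟨a, ha⟩ := h
      exact ⟨a, fun _ => ha⟩
    · exact ⟨Classical.arbitrary M, fun h' => absurd h' h⟩
  have wf : WellFounded r := IsWellFounded.wf
  refine ⟨fun b => wf.min _ (hne b), ?_, fun b hb => wf.min_mem _ (hne b) hb⟩
  -- The tuples whose distinguished entry is not the least witness, because a smaller one exists.
  have hE : (∅ : Set M).Definable L {b : Option (Fin k) → M |
      ∃ a, (fun o : Option (Option (Fin k)) => o.elim a b) ∈
        {c : Option (Option (Fin k)) → M |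
          (c ∘ fun o : Option (Fin k) => o.elim none (some ∘ some)) ∈ D} ∩
        {c | r (c none) (c (some none))}} :=
    definable_exists_option ((hD.preimage_comp _).inter (hr.preimage_comp ![none, some none]))
  unfold Set.DefinableFun
  convert! hD.inter hE.compl using 1
  ext b
  have key : ∀ a : M, ((fun o : Option (Option (Fin k)) => o.elim a b) ∘
      fun o : Option (Fin k) => o.elim none (some ∘ some)) ∈ D ↔
        a ∈ {a : M | (fun o : Option (Fin k) => o.elim a (b ∘ some)) ∈ D} := by
    intro a
    rw [Set.mem_ofPred_eq]
    refine iff_of_eq (congrArg (· ∈ D) ?_)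
    funext o; cases o <;> rfl
  have hb : b ∈ D ↔ b none ∈ {a : M | (fun o : Option (Fin k) => o.elim a (b ∘ some)) ∈ D} :=
    iff_of_eq (congrArg (· ∈ D) (eta b).symm)
  simp only [Function.tupleGraph, Set.mem_ofPred_eq, Set.mem_inter_iff, Set.mem_compl_iff,
    not_exists, not_and]
  rw [hb]
  change wf.min _ (hne (b ∘ some)) = b none ↔ _
  constructor
  · intro h
    rw [← h]
    refine ⟨wf.min_mem _ (hne _), fun a ha hlt => wf.not_lt_min _ ((key a).1 ha) ?_⟩
    exact h ▸ hlt
  · rintro ⟨h1, h2⟩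
    rcases trichotomous_of r (wf.min _ (hne (b ∘ some))) (b none) with h | h | h
    · exact absurd h (h2 _ ((key _).2 (wf.min_mem _ (hne (b ∘ some)))))
    · exact h
    · exact absurd h (wf.not_lt_min _ h1)

end Skolem

/-! ### The language of the well-order -/

section Language

/-- The language of a well-order, padded to be countably infinite: one relation symbol for each
arity, of which only the binary one will carry information. -/
def wellOrderLanguage : FirstOrder.Language.{u, v} := ⟨fun _ => PEmpty, fun _ => PUnit⟩

/-- The binary symbol is interpreted as a fixed well-order of `M`, all others as empty relations. -/
abbrev wellOrderStructure (M : Type x) : wellOrderLanguage.{u, v}.Structure M where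
  funMap f := f.elim
  RelMap {n} _ b := ∃ h : n = 2, WellOrderingRel (b (Fin.cast h.symm 0)) (b (Fin.cast h.symm 1))

theorem card_wellOrderLanguage : wellOrderLanguage.{u, v}.card = Cardinal.aleph0 := by
  have : Countable wellOrderLanguage.{u, v}.Symbols := by
    unfold Language.Symbols wellOrderLanguage; infer_instance
  have : Infinite wellOrderLanguage.{u, v}.Symbols := by
    unfold Language.Symbols wellOrderLanguage; infer_instance
  exact Cardinal.mk_eq_aleph0 _

end Language

/-! ### Definable functions of infinitely many variables -/

section FiniteSupport

variable {L : FirstOrder.Language.{u, v}} {M : Type x} [L.Structure M] {I : Type w}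

/-- A definable function of arbitrarily many variables depends on finitely many of them only, namely
those that are free in a defining formula, and is definable as a function of these. -/
theorem exists_definableFun_comp_eq [Nonempty M] {A : Set M} {g : (I → M) → M}
    (hg : A.DefinableFun L g) :
    ∃ (k : ℕ) (i : Fin k → I) (f : (Fin k → M) → M), A.DefinableFun L f ∧
      ∀ x, f (x ∘ i) = g x := by
  classical
  obtain ⟨φ, hφ⟩ := Set.definable_iff_exists_formula_sum.1 hg
  have hφ' : ∀ x a, g x = a ↔ φ.Realize (Sum.elim (fun m : A => (m : M)) fun o => o.elim a x) :=
    fun x a => Set.ext_iff.1 hφ (fun o => o.elim a x)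
  let J : Finset I := φ.freeVarFinset.toRight.eraseNone
  let i : Fin J.card → I := fun t => J.equivFin.symm t
  have hi : Function.Injective i := Subtype.val_injective.comp J.equivFin.symm.injective
  let ρ : φ.freeVarFinset → A ⊕ Option (Fin J.card) := fun p => match p with
    | ⟨.inl m, _⟩ => .inl m
    | ⟨.inr none, _⟩ => .inr none
    | ⟨.inr (some c), h⟩ => .inr (some (J.equivFin ⟨c, by simpa [J] using h⟩))
  -- `φ` with the variables indexed by `J` renamed by their position in `J`.
  have hρ : ∀ x a, Formula.Realize (φ.restrictFreeVar ρ)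
      (Sum.elim (fun m : A => (m : M)) fun o => o.elim a (x ∘ i)) ↔ g x = a := by
    intro x a
    rw [hφ']
    refine BoundedFormula.realize_restrictFreeVar _ ?_
    rintro ⟨m | _ | c, h⟩
    · rfl
    · rfl
    · simp [ρ, i]
  have hext : ∀ b : Fin J.card → M, ∃ x : I → M, x ∘ i = b := fun b =>
    ⟨Function.extend i b fun _ => Classical.arbitrary M, Function.extend_comp hi _ _⟩
  choose E hE using hext
  have hfg : ∀ x, g (E (x ∘ i)) = g x := fun x => by
    rw [← hρ, hE, hρ]
  refine ⟨J.card, i, fun b => g (E b), ?_, hfg⟩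
  refine Set.definable_iff_exists_formula_sum.2 ⟨φ.restrictFreeVar ρ, ?_⟩
  ext b
  have h := hρ (E (b ∘ some)) (b none)
  rw [hE] at h
  have eta : (fun o : Option (Fin J.card) => o.elim (b none) (b ∘ some)) = b := by
    funext o; cases o <;> rfl
  rw [eta] at h
  exact h.symm

end FiniteSupport

/-! ### The definable hull of the coordinates in an ultrapower -/

section Hull

variable {L : FirstOrder.Language.{u, v}} {M : Type x} [L.Structure M] {I : Type w}

/-- The class of `g` in the ultrapower of `M` by `W`. -/
def productMk (W : Ultrafilter (I → M)) (g : (I → M) → M) :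
    (W : Filter (I → M)).Product fun _ => M :=
  (g : (W : Filter (I → M)).Product fun _ => M)

theorem productMk_eq_iff {W : Ultrafilter (I → M)} {g h : (I → M) → M} :
    productMk W g = productMk W h ↔ ∀ᶠ x in (W : Filter (I → M)), g x = h x :=
  Quotient.eq''

theorem productMk_surjective (W : Ultrafilter (I → M)) : Function.Surjective (productMk W) :=
  fun a => Quotient.inductionOn' a fun g => ⟨g, rfl⟩

/-- Łoś's theorem. -/
theorem realize_productMk [Nonempty M] {W : Ultrafilter (I → M)} {α : Type*} (φ : L.Formula α)
    (g : α → (I → M) → M) :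
    (φ.Realize fun t => productMk W (g t)) ↔
      ∀ᶠ x in (W : Filter (I → M)), φ.Realize fun t => g t x :=
  Ultraproduct.realize_formula_cast φ g

/-- Translates between the last bound variable of the Tarski–Vaught test and the distinguished
variable `none` of `HasDefinableSkolemFunctions`. -/
theorem realize_snoc_iff {N : Type*} [L.Structure N] {n : ℕ} (φ : L.BoundedFormula Empty (n + 1))
    (b : Fin n → N) (a : N) :
    (φ.toFormula.relabel (Sum.elim Empty.elim
      (Fin.lastCases none some : Fin (n + 1) → Option (Fin n)))).Realize
        (fun o => o.elim a b) ↔ φ.Realize default (Fin.snoc b a : Fin (n + 1) → N) := by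
  rw [Formula.realize_relabel, BoundedFormula.realize_toFormula]
  refine iff_of_eq (congrArg₂ φ.Realize (Subsingleton.elim _ _) (funext fun t => ?_))
  refine Fin.lastCases ?_ (fun t => ?_) t <;> simp

variable (L) in
/-- The classes of the functions that are definable with parameters from `M`. -/
def definableSubstructure (W : Ultrafilter (I → M)) :
    L.Substructure ((W : Filter (I → M)).Product fun _ => M) where
  carrier := {a | ∃ g, (Set.univ : Set M).DefinableFun L g ∧ productMk W g = a}
  fun_mem {n} f a ha := by
    choose g hg hga using ha
    obtain rfl : (fun t => productMk W (g t)) = a := funext hga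
    exact ⟨fun x => Structure.funMap f fun t => g t x,
      .comp (g := fun x t => g t x) hg (.of_empty (.fun_symbol f)),
      (Ultraproduct.funMap_cast f g).symm⟩

/-- Definable Skolem functions, applied pointwise to definable functions, provide the witnesses for
the Tarski–Vaught test. -/
theorem definableSubstructure_isElementary [Nonempty M] (hL : HasDefinableSkolemFunctions L M)
    (W : Ultrafilter (I → M)) : (definableSubstructure L W).IsElementary := by
  refine Substructure.isElementary_of_exists _ fun n φ a c h => ?_
  choose g hg hga using fun t => (a t).2
  obtain ⟨gc, rfl⟩ := productMk_surjective W c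
  obtain ⟨f, hf, hfφ⟩ := hL n (φ.toFormula.relabel (Sum.elim Empty.elim
      (Fin.lastCases none some : Fin (n + 1) → Option (Fin n))))
  -- `x ↦ f (g x)` is a pointwise witness wherever `gc` is one, hence almost everywhere.
  have los : ∀ d : (I → M) → M, φ.Realize default
      (Fin.snoc ((↑) ∘ a) (productMk W d) : Fin (n + 1) → (W : Filter (I → M)).Product fun _ => M) ↔
      ∀ᶠ x in (W : Filter (I → M)), (φ.toFormula.relabel (Sum.elim Empty.elim
      (Fin.lastCases none some : Fin (n + 1) → Option (Fin n)))).Realize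
        (fun o => o.elim (d x) fun t => g t x) := by
    intro d
    rw [← realize_snoc_iff]
    have h1 : ∀ x, (fun o : Option (Fin n) => o.elim (d x) fun t => g t x) =
        fun o => (o.elim d g : (I → M) → M) x := fun x => by funext o; cases o <;> rfl
    simp only [h1]
    rw [← realize_productMk]
    refine iff_of_eq (congrArg _ (funext fun o => ?_))
    cases o with
    | none => rfl
    | some t => exact (hga t).symm
  refine ⟨⟨productMk W fun x => f fun t => g t x, _,
    .comp (g := fun x t => g t x) hg (.of_empty hf), rfl⟩, (los _).2 ?_⟩
  exact ((los _).1 h).mono fun x hx => hfφ _ ⟨_, hx⟩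

/-- The elementary substructure of the ultrapower generated by `M` and the coordinate functions. -/
def definableHull [Nonempty M] (hL : HasDefinableSkolemFunctions L M)
    (W : Ultrafilter (I → M)) :
    L.ElementarySubstructure ((W : Filter (I → M)).Product fun _ => M) :=
  ⟨definableSubstructure L W, definableSubstructure_isElementary hL W⟩

variable [Nonempty M] (hL : HasDefinableSkolemFunctions L M) (W : Ultrafilter (I → M))

/-- The class of a definable function, as an element of the hull. -/
def hullMk (g : (I → M) → M) (hg : (Set.univ : Set M).DefinableFun L g) : definableHull hL W :=
  ⟨productMk W g, g, hg, rfl⟩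

variable {hL W}

theorem hullMk_eq_iff {g h : (I → M) → M} {hg : (Set.univ : Set M).DefinableFun L g}
    {hh : (Set.univ : Set M).DefinableFun L h} :
    hullMk hL W g hg = hullMk hL W h hh ↔ ∀ᶠ x in (W : Filter (I → M)), g x = h x :=
  Subtype.ext_iff.trans productMk_eq_iff

theorem exists_hullMk_eq (a : definableHull hL W) : ∃ g hg, hullMk hL W g hg = a := by
  obtain ⟨_, g, hg, rfl⟩ := a
  exact ⟨g, hg, rfl⟩

/-- Łoś's theorem for the hull. -/
theorem realize_iff_eventually {α : Type*} (φ : L.Formula α) {b : α → definableHull hL W}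
    {g : α → (I → M) → M} (hbg : ∀ t, (b t : (W : Filter (I → M)).Product fun _ => M) =
      productMk W (g t)) :
    φ.Realize b ↔ ∀ᶠ x in (W : Filter (I → M)), φ.Realize fun t => g t x := by
  rw [← realize_productMk, ← (definableHull hL W).subtype.map_formula]
  exact iff_of_eq (congrArg _ (funext hbg))

variable (hL W)

/-- An element of `M` as the class of a constant function. -/
def diagonalEmbedding : M ↪ₑ[L] definableHull hL W where
  toFun m := hullMk hL W (fun _ => m) (L.definableFun_const I (Set.mem_univ m))
  map_formula' _ φ b :=
    (realize_iff_eventually φ (g := fun t _ => b t) fun _ => rfl).trans eventually_const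

/-- An element `i` of `I` as the class of the coordinate function `x ↦ x i`. -/
def coordinate (i : I) : definableHull hL W :=
  hullMk hL W (fun x => x i) (.proj L)

variable {hL W}

theorem realize_parameters_coordinates {k : ℕ} (φ : L.Formula (M ⊕ Fin k)) (i : Fin k → I) :
    φ.Realize (Sum.elim (fun m => diagonalEmbedding hL W m) fun s => coordinate hL W (i s)) ↔
      ∀ᶠ x in (W : Filter (I → M)), φ.Realize (Sum.elim (fun m => m) (x ∘ i)) := by
  rw [realize_iff_eventually φ (g := Sum.elim (fun m _ => m) (fun s x => x (i s)))
    (by rintro (m | s) <;> rfl)]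
  refine eventually_congr (.of_forall fun x => iff_of_eq (congrArg _ ?_))
  funext t; cases t <;> rfl

/-- The natural extension of `f` acts pointwise on the classes of the coordinate functions. -/
theorem naturalExtension_coordinates {k : ℕ} {f : (Fin k → M) → M}
    (hf : (Set.univ : Set M).DefinableFun L f)
    {F : (Fin k → definableHull hL W) → definableHull hL W}
    (hF : IsNaturalExtension (diagonalEmbedding hL W) f F) (i : Fin k → I) :
    F (fun s => coordinate hL W (i s)) =
      hullMk hL W (fun x => f (x ∘ i)) (.comp (g := fun x s => x (i s)) (fun _ => .proj L) hf) := by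
  obtain ⟨φ, hφ, hφF⟩ := hF
  rw [hφF, realize_iff_eventually φ (g := Sum.elim (fun m _ => m)
    (fun o => o.elim (fun x => f (x ∘ i)) fun s x => x (i s)))
    (by rintro (m | _ | s) <;> rfl)]
  refine .of_forall fun x => ?_
  convert! (hφ (x ∘ i) (f (x ∘ i))).1 rfl using 1
  funext t; rcases t with m | _ | s <;> rfl

end Hull

/-! ### Tight indiscernibles -/

/-- The coordinate functions are tight indiscernibles generating the hull. Nonprincipality of `U`
is needed only to keep them apart from each other and from the elements of `M`. -/
theorem isTightIndiscernibles_coordinate {L : FirstOrder.Language.{u, v}} {M : Type x}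
    [L.Structure M] [Nonempty M] {I : Type w} [LinearOrder I]
    (hL : HasDefinableSkolemFunctions L M) {U : Ultrafilter M} (hU : ∀ m, {m} ∉ U) (d : M) :
    IsTightIndiscernibles (diagonalEmbedding hL (iteratedLimit I U d))
      (coordinate hL (iteratedLimit I U d)) where
  injective i j h := by
    have h' := productMk_eq_iff.1 (congrArg Subtype.val h)
    rcases lt_trichotomy i j with hij | hij | hij
    · exact absurd h' (not_eventually_iteratedLimit_eq_of_lt hU d hij)
    · exact hij
    · exact absurd (h'.mono fun _ hx => hx.symm) (not_eventually_iteratedLimit_eq_of_lt hU d hij)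
  notMem := by
    rintro i ⟨m, h⟩
    exact not_eventually_iteratedLimit_eq hU d i m
      ((productMk_eq_iff.1 (congrArg Subtype.val h)).mono fun _ hx => hx.symm)
  indiscernible k φ i j hi hj := by
    rw [realize_parameters_coordinates, realize_parameters_coordinates,
      eventually_iteratedLimit U d hi (P := fun b => φ.Realize (Sum.elim (fun m => m) b)),
      eventually_iteratedLimit U d hj (P := fun b => φ.Realize (Sum.elim (fun m => m) b))]
  generates a := by
    obtain ⟨g, hg, rfl⟩ := exists_hullMk_eq a
    obtain ⟨k, i, f, hf, hfg⟩ := exists_definableFun_comp_eq hg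
    obtain ⟨F, hF, -⟩ := existsUnique_isNaturalExtension
      (diagonalEmbedding hL (iteratedLimit I U d)) f hf
    refine ⟨k, f, F, i, hf, hF, ?_⟩
    rw [naturalExtension_coordinates hf hF, hullMk_eq_iff]
    exact .of_forall hfg
  tight k f F i j hf hF hi hj hij h := by
    rw [naturalExtension_coordinates hf hF, naturalExtension_coordinates hf hF] at h
    obtain ⟨a, ha⟩ := exists_of_eventually_iteratedLimit U d hi hj hij
      (P := fun a b => f a = f b) (hullMk_eq_iff.1 h)
    refine ⟨f a, ?_⟩
    rw [naturalExtension_coordinates hf hF, h]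
    exact Subtype.ext (productMk_eq_iff.2 ha)


end TightIndiscernibles

theorem theorem1p3 (L : FirstOrder.Language.{u, v}) (M : Type x) [L.Structure M] [Infinite M] :
    ∃ (L₁ : FirstOrder.Language.{max u v, max u v}) (_ : L₁.Structure M)
      (incl : FirstOrder.Language.LHom L L₁),
      incl.Injective ∧ incl.IsExpansionOn M ∧
      TightIndiscernibles.HasDefinableSkolemFunctions L₁ M ∧
      L₁.card = max L.card Cardinal.aleph0 ∧
      ∀ (I : Type w) [LinearOrder I],
        ∃ (N : Type (max x w)) (_ : L₁.Structure N)
          (e : FirstOrder.Language.ElementaryEmbedding L₁ M N) (ι : I → N),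
          TightIndiscernibles.IsTightIndiscernibles e ι := by
  open TightIndiscernibles FirstOrder FirstOrder.Language in
  let : wellOrderLanguage.{max u v, max u v}.Structure M := wellOrderStructure M
  have hr : (∅ : Set M).Definable (L.sum wellOrderLanguage.{max u v, max u v})
      {b : Fin 2 → M | WellOrderingRel (b 0) (b 1)} := by
    refine Set.empty_definable_iff.2 ⟨Relations.formula₂
      (L := L.sum wellOrderLanguage.{max u v, max u v})
      (Sum.inr PUnit.unit) (Term.var 0) (Term.var 1), ?_⟩
    ext b
    refine Iff.trans ?_ Formula.realize_rel₂.symm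
    exact ⟨fun h => ⟨rfl, h⟩, fun ⟨_, h⟩ => h⟩
  have hS := hasDefinableSkolemFunctions_of_wellOrder hr
  refine ⟨L.sum wellOrderLanguage.{max u v, max u v}, inferInstance, LHom.sumInl,
    LHom.sumInl_injective, inferInstance, hS, ?_, fun I _ => ?_⟩
  -- The idle symbols make the cardinality at least `ℵ₀`.
  · rw [card_sum, card_wellOrderLanguage, Cardinal.lift_aleph0,
      Cardinal.lift_id'.{max u v, max u v}]
    exact Cardinal.add_eq_max' le_rfl
  · exact ⟨definableHull hS (iteratedLimit I (Filter.hyperfilter M) (Classical.arbitrary M)),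
      inferInstance, diagonalEmbedding hS _, coordinate hS _, isTightIndiscernibles_coordinate hS
        (fun m => Filter.notMem_hyperfilter_of_finite (Set.finite_singleton m)) _⟩
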